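/- **Setting.** Let $n\ge 2$ agents $V=\{1,\dots,n\}$ have states $g_i=[p_i^\top,\phi_i]^\top\in\mathbb{R}^3$ (planar position and yaw angle); agents $1,2$ are the leaders ($l$) and agents $3,\dots,n$ the followers ($f$). Let $G$ be a bidirectional sensing graph on $V$ (no self-loops) that is 2-rooted: there are two agents such that every other agent $i$ remains joined by a path to at least one of them that is left, whenever one agent other than $i$ is removed. A *dual-entry path* (DEP) consists of two distinct entry agents $i,j$ and further distinct inner agents $v_1,\dots,v_\ell$, $\ell\ge1$, with the directed edges $(i,v_1)$, $(j,v_\ell)$ and $(v_r,v_{r+1}),(v_{r+1},v_r)$ for $1\le r<\ell$, where $(u,v)$ means that $v$ measures $u$. A *DEP-induced graph* is obtained from the edgeless graph on $\{1,2\}$ by successively attaching DEPs $G_{\mathcal P_1},\dots,G_{\mathcal P_\kappa}$, where $G_{\mathcal P_h}$ meets the agents already present exactly in its two entry agents $i_h,j_h$. Let $\mathcal L$ be a DEP-induced graph that is a spanning subgraph of $G$; denote its edge set by $E$ and the inner agents of $G_{\mathcal P_h}$ by $v^h_1,\dots,v^h_{\ell_h}$. Let $\tilde g_1,\dots,\tilde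 g_n\in\mathbb{R}^3$ be nominal states and $\theta\in\mathbb{R}$ a scaling direction, and put $$\Theta=\begin{bmatrix}\cos\theta&-\sin\theta&0\\ \sin\theta&\cos\theta&0\\0&0&1\end{bmatrix},\qquad \tilde g_{uv,\theta}=\Theta^\top(\tilde g_u-\tilde g_v),\qquad w_{uv}=\operatorname{diag}(\tilde g_{uv,\theta}),\qquad W_{uv}=w_{uv}\Theta^\top .$$ Let $C=\{(i,j,k)\in V^3: (i,k),(j,k)\in E,\ i<j\}$ and let $M\in\mathbb{R}^{3n\times3n}$ be the matrix-valued Laplacian with the $3\times 3$ blocks $$M_{ki}=\sum_{j:(i,j,k)\in C}W_{jk}+\sum_{j:(j,i,k)\in C}W_{kj}\quad(i\ne k),\qquad M_{kk}=\sum_{(a,b):(a,b,k)\in C}W_{ab},$$ so that the $k$-th block row of $Mg$ is $\sum_{(i,j,k)\in C}\bigl(W_{jk}(g_i-g_k)+W_{ki}(g_j-g_k)\bigr)$. Write $M=\hat M\operatorname{diag}(\Theta^\top)$ with $\operatorname{diag}(\Theta^\top)$ block diagonal, and let $\hat M_{fl},\hat M_{ff}$ be the follower-leader and follower-follower blocks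 of $\hat M$. **Assumption 2.** For every $h$, all three components of $\tilde g_{uv,\theta}$ are nonzero for $\{u,v\}=\{i_h,j_h\}$ and for each pair of consecutive inner agents $\{u,v\}=\{v^h_r,v^h_{r+1}\}$, $1\le r<\ell_h$. **Assumption 3.** For every $h$ and every $2\le r\le \ell_h$, all three components of $\tilde g_{uv,\theta}$ with $u=i_h$, $v=v^h_r$ are nonzero. **Theorem.** Under Assumptions 2 and 3, $\hat M_{ff}$ is nonsingular, so that for every leader target $g_l^*$ the follower target $g_f^*=-(\hat M_{ff}\operatorname{diag}(\Theta^\top))^{-1}\hat M_{fl}\operatorname{diag}(\Theta^\top)g_l^*$ is well defined; if $g_l^*$ is the leader part of $g_i^*=\Theta\operatorname{diag}(s)\Theta^\top\tilde g_i+\tau$ $(i\in V)$ with constants $s,\tau\in\mathbb{R}^3$, then $g_f^*$ is its follower part. Moreover there are a diagonal matrix $D=\operatorname{diag}(D_k)_{k\ge 3}$ with nonzero diagonal blocks $D_k\in\mathbb{R}^{3\times3}$ and constants $c,\lambda>0$ such that, for every constant leader target $g_l^*$, the law $$g_l=g_l^*,\quad \dot g_l=0,\qquad \dot g_f=-\operatorname{diag}(\Theta)\,D\,\hat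 M_{ff}\operatorname{diag}(\Theta^\top)\,\delta_f,\qquad \delta_f=g_f-g_f^*,$$ has a solution on $[0,\infty)$ for every initial follower state, and every solution satisfies $\|\delta_f(t)\|\le c\,e^{-\lambda t}\|\delta_f(0)\|$ for all $t\ge0$; that is, $\delta_f$ converges to zero globally and exponentially. -/

import Mathlib

open scoped Matrix Kronecker

noncomputable section

/-! ### Two-rooted graphs

Agents are `Fin n`. A bidirectional sensing graph (no self-loops, every edge together with its
reverse) is a `SimpleGraph (Fin n)`. -/

/-- Agent `i` is 2-reachable from the non-singleton set `U`: after removing any agent `v ≠ i`, some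
remaining agent of `U` is joined to `i` by a path. -/
def TwoReachable {V : Type*} (G : SimpleGraph V) (U : Set V) (i : V) : Prop :=
  U.Nontrivial ∧ ∀ v : V, ∀ hi : i ≠ v, ∃ u ∈ U, ∃ hu : u ≠ v,
    (G.induce {w | w ≠ v}).Reachable ⟨u, hu⟩ ⟨i, hi⟩

/-- There are two agents (roots) from which every other agent is 2-reachable. -/
def IsTwoRooted {V : Type*} (G : SimpleGraph V) : Prop :=
  ∃ a b : V, a ≠ b ∧ ∀ i : V, i ≠ a → i ≠ b → TwoReachable G {a, b} i

/-! ### Dual-entry paths and DEP-induced graphs -/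

/-- A dual-entry path: two distinct entry agents and `len ≥ 1` distinct inner agents
`inner 0, …, inner (len - 1)`. -/
structure DEP (V : Type*) where
  entryI : V
  entryJ : V
  len : ℕ
  len_pos : 0 < len
  inner : Fin len → V
  entry_ne : entryI ≠ entryJ
  inner_injective : Function.Injective inner
  inner_ne_entryI : ∀ r, inner r ≠ entryI
  inner_ne_entryJ : ∀ r, inner r ≠ entryJ

/-- The agents of a dual-entry path. -/
def DEP.verts {V : Type*} (P : DEP V) : Set V :=
  {P.entryI, P.entryJ} ∪ Set.range P.inner

/-- The directed edges of a dual-entry path: `entryI` to the first inner agent, `entryJ` to the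
last inner agent, and both directions between consecutive inner agents. `P.Edge u v` means that
`v` measures `u`. -/
def DEP.Edge {V : Type*} (P : DEP V) (u v : V) : Prop :=
  (u = P.entryI ∧ v = P.inner ⟨0, P.len_pos⟩) ∨
  (u = P.entryJ ∧ v = P.inner ⟨P.len - 1, Nat.sub_lt P.len_pos Nat.one_pos⟩) ∨
  ∃ r s : Fin P.len, ((r : ℕ) + 1 = s ∨ (s : ℕ) + 1 = r) ∧ u = P.inner r ∧ v = P.inner s

/-- A DEP-induced graph on agents in `Fin n`, built from the two leaders (the agents numbered
`0` and `1`, with no edge) by attaching dual-entry paths `dep 0, …, dep (κ - 1)` successively: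
each path meets the part built so far exactly in its two entry agents. The numbering of
the inner agents is left arbitrary. -/
structure DEPInduced (n : ℕ) where
  κ : ℕ
  dep : Fin κ → DEP (Fin n)
  attach : ∀ h : Fin κ,
    (dep h).verts ∩ ({v : Fin n | (v : ℕ) < 2} ∪ ⋃ h' : Fin κ, ⋃ _ : h' < h, (dep h').verts) =
      {(dep h).entryI, (dep h).entryJ}

/-- All agents of the DEP-induced graph. -/
def DEPInduced.verts {n : ℕ} (L : DEPInduced n) : Set (Fin n) :=
  {v : Fin n | (v : ℕ) < 2} ∪ ⋃ h : Fin L.κ, (L.dep h).verts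

/-- The directed edges of the DEP-induced graph. -/
def DEPInduced.Edge {n : ℕ} (L : DEPInduced n) (u v : Fin n) : Prop :=
  ∃ h : Fin L.κ, (L.dep h).Edge u v

/-- `L` is a spanning subgraph of the sensing graph `G`. -/
def DEPInduced.IsSpanningIn {n : ℕ} (L : DEPInduced n) (G : SimpleGraph (Fin n)) : Prop :=
  L.verts = Set.univ ∧ ∀ u v : Fin n, L.Edge u v → G.Adj u v

/-! ### Nominal configuration and the two non-degeneracy assumptions -/

/-- `Θ = diag(R(θ), 1)`. -/
def Theta (θ : ℝ) : Matrix (Fin 3) (Fin 3) ℝ :=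
  !![Real.cos θ, -Real.sin θ, 0; Real.sin θ, Real.cos θ, 0; 0, 0, 1]

/-- The three components of `Θᵀ g̃_u - Θᵀ g̃_v`, i.e. the projected position differences
and the yaw difference between the agents `u` and `v`. -/
def nominalDiff {n : ℕ} (gt : Fin n → Fin 3 → ℝ) (θ : ℝ) (u v : Fin n) : Fin 3 → ℝ :=
  (Theta θ)ᵀ *ᵥ gt u - (Theta θ)ᵀ *ᵥ gt v

/-- On every dual-entry path, the entry pair and all bidirectional edges have three nonzero
nominal differences. -/
def RankAssumption {n : ℕ} (L : DEPInduced n) (gt : Fin n → Fin 3 → ℝ) (θ : ℝ) : Prop :=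
  ∀ h : Fin L.κ, ∀ u v : Fin n,
    (((L.dep h).Edge u v ∧ (L.dep h).Edge v u) ∨
      (u = (L.dep h).entryI ∧ v = (L.dep h).entryJ)) →
    ∏ c : Fin 3, nominalDiff gt θ u v c ≠ 0

/-- On every dual-entry path, each inner agent from the second one on has three nonzero nominal
differences to the entry agent `entryI` (indices of inner agents start at `0` here). -/
def StabilityAssumption {n : ℕ} (L : DEPInduced n) (gt : Fin n → Fin 3 → ℝ) (θ : ℝ) : Prop :=
  ∀ h : Fin L.κ, ∀ r : Fin (L.dep h).len, 1 ≤ (r : ℕ) →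
    ∏ c : Fin 3, nominalDiff gt θ (L.dep h).entryI ((L.dep h).inner r) c ≠ 0

/-! ### The matrix-valued Laplacian -/

/-- The diagonal matrix `w_{ij}`. -/
def wMat {n : ℕ} (gt : Fin n → Fin 3 → ℝ) (θ : ℝ) (i j : Fin n) : Matrix (Fin 3) (Fin 3) ℝ :=
  Matrix.diagonal (nominalDiff gt θ i j)

/-- `W_{ij} = w_{ij} Θᵀ`. -/
def WMat {n : ℕ} (gt : Fin n → Fin 3 → ℝ) (θ : ℝ) (i j : Fin n) : Matrix (Fin 3) (Fin 3) ℝ :=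
  wMat gt θ i j * (Theta θ)ᵀ

/-- `(i, j, k)` is a constraint index: `i < j` and `k` measures both `i` and `j`. -/
def IsConstraint {n : ℕ} (E : Fin n → Fin n → Prop) (i j k : Fin n) : Prop :=
  E i k ∧ E j k ∧ i < j

open Classical in
/-- The block `M_{ki}` of the matrix-valued Laplacian, which collects the coefficient of `g_i` in
the constraints `W_{bk} (g_a - g_k) + W_{ka} (g_b - g_k) = 0`, `(a, b, k)` a constraint index. The
coefficient of `g_k` there is `-(W_{bk} + W_{ka}) = W_{ab}`. -/
def laplacianBlock {n : ℕ} (E : Fin n → Fin n → Prop) (gt : Fin n → Fin 3 → ℝ) (θ : ℝ)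
    (k i : Fin n) : Matrix (Fin 3) (Fin 3) ℝ :=
  if k = i then
    ∑ a : Fin n, ∑ b : Fin n, if IsConstraint E a b k then WMat gt θ a b else 0
  else
    (∑ j : Fin n, if IsConstraint E i j k then WMat gt θ j k else 0) +
      ∑ j : Fin n, if IsConstraint E j i k then WMat gt θ k j else 0

/-- The matrix-valued Laplacian `M`. -/
def laplacian {n : ℕ} (E : Fin n → Fin n → Prop) (gt : Fin n → Fin 3 → ℝ) (θ : ℝ) :
    Matrix (Fin n × Fin 3) (Fin n × Fin 3) ℝ :=
  Matrix.of fun p q => laplacianBlock E gt θ p.1 q.1 p.2 q.2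

/-- The block-diagonal matrix `diag(Θ)` over a set `ι` of agents. -/
def diagTheta (ι : Type*) [DecidableEq ι] (θ : ℝ) : Matrix (ι × Fin 3) (ι × Fin 3) ℝ :=
  (1 : Matrix ι ι ℝ) ⊗ₖ Theta θ

/-- `M̂`, determined by `M = M̂ diag(Θᵀ)` (`Θ` is orthogonal). -/
def laplacianHat {n : ℕ} (E : Fin n → Fin n → Prop) (gt : Fin n → Fin 3 → ℝ) (θ : ℝ) :
    Matrix (Fin n × Fin 3) (Fin n × Fin 3) ℝ :=
  laplacian E gt θ * diagTheta (Fin n) θ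

/-! ### Leaders, followers and the control law -/

/-- The leaders: the agents numbered `0` and `1`. -/
abbrev Leader (n : ℕ) := {k : Fin n // (k : ℕ) < 2}

/-- The followers: all other agents. -/
abbrev Follower (n : ℕ) := {k : Fin n // 2 ≤ (k : ℕ)}

/-- `g_l`, the leader part of a stacked state. -/
def leaderPart {n : ℕ} (g : Fin n × Fin 3 → ℝ) : Leader n × Fin 3 → ℝ :=
  fun p => g (p.1.1, p.2)

/-- `g_f`, the follower part of a stacked state. -/
def followerPart {n : ℕ} (g : Fin n × Fin 3 → ℝ) : Follower n × Fin 3 → ℝ :=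
  fun p => g (p.1.1, p.2)

/-- The follower-follower block of `M̂`. -/
def hatFF {n : ℕ} (E : Fin n → Fin n → Prop) (gt : Fin n → Fin 3 → ℝ) (θ : ℝ) :
    Matrix (Follower n × Fin 3) (Follower n × Fin 3) ℝ :=
  (laplacianHat E gt θ).submatrix (fun p => (p.1.1, p.2)) (fun p => (p.1.1, p.2))

/-- The follower-leader block of `M̂`. -/
def hatFL {n : ℕ} (E : Fin n → Fin n → Prop) (gt : Fin n → Fin 3 → ℝ) (θ : ℝ) :
    Matrix (Follower n × Fin 3) (Leader n × Fin 3) ℝ :=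
  (laplacianHat E gt θ).submatrix (fun p => (p.1.1, p.2)) (fun p => (p.1.1, p.2))

/-- The target state with maneuver parameters `s`, `τ`: agent `i` has the target
`Θ diag(s) Θᵀ g̃_i + τ`. -/
def targetState {n : ℕ} (gt : Fin n → Fin 3 → ℝ) (θ : ℝ) (s τ : Fin 3 → ℝ) :
    Fin n × Fin 3 → ℝ :=
  fun p => ((Theta θ * Matrix.diagonal s * (Theta θ)ᵀ) *ᵥ gt p.1 + τ) p.2

/-- The follower target determined by the leader target `gl`:
`g_f^* = -(M̂_ff diag(Θᵀ))⁻¹ M̂_fl diag(Θᵀ) g_l^*`. -/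
def followerTarget {n : ℕ} (E : Fin n → Fin n → Prop) (gt : Fin n → Fin 3 → ℝ) (θ : ℝ)
    (gl : Leader n × Fin 3 → ℝ) : Follower n × Fin 3 → ℝ :=
  -((hatFF E gt θ * (diagTheta (Follower n) θ)ᵀ)⁻¹ *ᵥ
    ((hatFL E gt θ * (diagTheta (Leader n) θ)ᵀ) *ᵥ gl))

/-- The follower tracking error `δ_f = g_f - g_f^*`. -/
def trackingError {n : ℕ} (E : Fin n → Fin n → Prop) (gt : Fin n → Fin 3 → ℝ) (θ : ℝ)
    (gl : Leader n × Fin 3 → ℝ) (g : Fin n × Fin 3 → ℝ) : Follower n × Fin 3 → ℝ :=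
  followerPart g - followerTarget E gt θ gl

/-- `g` is a trajectory on `[0, ∞)` of the stationary-leader law with gain matrix
`D = diag(d)` and leader target `gl`: the leaders stay at `gl`, and
`ġ_f = -diag(Θ) D M̂_ff diag(Θᵀ) δ_f`. -/
structure IsStationaryLeaderTrajectory {n : ℕ} (E : Fin n → Fin n → Prop)
    (gt : Fin n → Fin 3 → ℝ) (θ : ℝ) (d : Follower n → Fin 3 → ℝ)
    (gl : Leader n × Fin 3 → ℝ) (g : ℝ → Fin n × Fin 3 → ℝ) : Prop where
  leader_eq : ∀ t : ℝ, 0 ≤ t → leaderPart (g t) = gl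
  leader_deriv : ∀ t : ℝ, 0 ≤ t →
    HasDerivWithinAt (fun τ => leaderPart (g τ)) 0 (Set.Ici 0) t
  follower_deriv : ∀ t : ℝ, 0 ≤ t →
    HasDerivWithinAt (fun τ => followerPart (g τ))
      (-((diagTheta (Follower n) θ * Matrix.diagonal (fun p => d p.1 p.2) * hatFF E gt θ *
        (diagTheta (Follower n) θ)ᵀ) *ᵥ trackingError E gt θ gl (g t))) (Set.Ici 0) t

end

open scoped Matrix Kronecker

/-! In the rotated coordinates `Θᵀ g` every block of `M̂` is diagonal, so the three components
decouple. Each follower is an inner agent of exactly one dual-entry path and measures only its two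
neighbours there. Its row of `M̂` in component `c` therefore says that the points `(y, ξ)` of the
agent and its neighbours are collinear, where `y` is the nominal coordinate and `ξ` the unknown
(`laplacianHat_mulVec_eq_zero_iff`).

If `ξ` vanishes at the entries, these relations put the path's points on a line through `(y₀, 0)`; a
second zero at some `y ≠ y₀` makes `ξ` vanish along the path. The second zero may be the far entry,
or the first place where the rows are cut off (`path_values_eq_zero`). Induction over the paths then
shows that `M̂_ff` and all its compressions to initial segments of the order of construction are
injective (`eq_zero_of_hatFF_mulVec_eq_zero`). The full compression gives nonsingularity; since
collinearity holds for affine functions of `y`, the follower targets are as prescribed.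

Truncated injectivity also yields a diagonal gain, by a Fisher–Fuller type induction adding one
coordinate at a time (`exists_diagonal_stabilizer`). It carries along a quadratic Lyapunov form,
which gives uniform exponential decay directly, without spectral theory
(`exists_exponential_decay_of_lyapunov`). -/

/-! ### Diagonal stabilization and Lyapunov estimates -/

/-- On a subspace of a finite-dimensional space, a positive continuous function that is homogeneous
of degree two dominates a multiple of any other such function. -/
theorem exists_pos_mul_lt_of_homogeneous {E : Type*} [NormedAddCommGroup E] [NormedSpace ℝ E]
    [FiniteDimensional ℝ E] (p : Submodule ℝ E) {q r : E → ℝ} (hq : Continuous q)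
    (hr : Continuous r) (hq2 : ∀ (a : ℝ) x, q (a • x) = a ^ 2 * q x)
    (hr2 : ∀ (a : ℝ) x, r (a • x) = a ^ 2 * r x) (hpos : ∀ x ∈ p, x ≠ 0 → 0 < q x) :
    ∃ ε : ℝ, 0 < ε ∧ ∀ x ∈ p, x ≠ 0 → ε * r x < q x := by
  have hp : IsClosed (p : Set E) := p.closed_of_finiteDimensional
  have : ProperSpace E := FiniteDimensional.proper_real E
  have hK : IsCompact (Metric.sphere (0 : E) 1 ∩ p) := (isCompact_sphere 0 1).inter_right hp
  have hqK : ∀ x ∈ Metric.sphere (0 : E) 1 ∩ p, 0 < q x := fun x hx =>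
    hpos x hx.2 (ne_zero_of_mem_unit_sphere ⟨x, hx.1⟩)
  obtain ⟨C, hC⟩ := hK.exists_bound_of_continuousOn (f := fun x => r x / q x)
    (hr.continuousOn.div hq.continuousOn fun x hx => (hqK x hx).ne')
  -- The absolute value is needed because `C` may be negative when the subspace is zero; the `+ 1`
  -- makes the inequality strict.
  refine ⟨1 / (|C| + 1), by positivity, fun x hx hx0 => ?_⟩
  have hn : 0 < ‖x‖ := norm_pos_iff.2 hx0
  have hy : ‖x‖⁻¹ • x ∈ Metric.sphere (0 : E) 1 ∩ p := by
    refine ⟨?_, p.smul_mem _ hx⟩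
    simp [norm_smul, hn.ne']
  have h1 := hC _ hy
  have h2 := hqK _ hy
  rw [Real.norm_eq_abs] at h1
  have h3 := (le_abs_self _).trans (h1.trans (le_abs_self C))
  rw [div_le_iff₀ h2, hq2, hr2] at h3
  rw [hq2] at h2
  have hs : 0 < (‖x‖⁻¹) ^ 2 := by positivity
  have h4 : 0 < q x := pos_of_mul_pos_right h2 hs.le
  have h5 : r x ≤ |C| * q x := by
    refine le_of_mul_le_mul_left ?_ hs
    linarith
  rw [one_div, inv_mul_lt_iff₀ (by positivity)]
  linarith

/-- A real linear map whose compressions to a complete flag of coordinate subspaces are injective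
becomes positive stable after rescaling its rows, with a quadratic Lyapunov function. The flag is
given by the lower sets of a level function `f`. -/
theorem exists_diagonal_stabilizer {ι α : Type*} [Fintype ι] [DecidableEq ι] [LinearOrder α]
    (f : ι → α) (A : (ι → ℝ) →L[ℝ] (ι → ℝ))
    (hA : ∀ S : Finset ι, (∀ a ∈ S, ∀ b, f b < f a → b ∈ S) → ∀ x : ι → ℝ,
      (∀ i ∉ S, x i = 0) → (∀ i ∈ S, A x i = 0) → x = 0) :
    ∃ (d : ι → ℝ) (B : (ι → ℝ) →L[ℝ] (ι → ℝ) →L[ℝ] ℝ), (∀ i, d i ≠ 0) ∧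
      (∀ x y, B x y = B y x) ∧ (∀ x, x ≠ 0 → 0 < B x x) ∧
      ∀ x, x ≠ 0 → 0 < B x (fun i => d i * A x i) := by
  -- Letting `d` vanish off `S` keeps the range of `D A` inside the vectors supported on `S`, so no
  -- projection is needed.
  suffices H : ∀ S : Finset ι, (∀ a ∈ S, ∀ b, f b < f a → b ∈ S) →
      ∃ (d : ι → ℝ) (B : (ι → ℝ) →L[ℝ] (ι → ℝ) →L[ℝ] ℝ), (∀ i, d i ≠ 0 ↔ i ∈ S) ∧
        (∀ x y, B x y = B y x) ∧ ∀ x, (∀ i ∉ S, x i = 0) → x ≠ 0 →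
          0 < B x x ∧ 0 < B x (fun i => d i * A x i) by
    obtain ⟨d, B, hd, hs, h⟩ := H Finset.univ (by simp)
    exact ⟨d, B, fun i => (hd i).2 (Finset.mem_univ i), hs, fun x hx => (h x (by simp) hx).1,
      fun x hx => (h x (by simp) hx).2⟩
  intro S
  -- Removing an element of maximal level keeps the set closed downwards, even when levels are tied.
  induction S using Finset.induction_on_max_value f with
  | empty =>
    intro _
    exact ⟨0, 0, by simp, by simp, fun x h0 hx => absurd (funext fun i => h0 i (by simp)) hx⟩
  | insert a S haS hmax ih =>
    intro hT
    have hS : ∀ c ∈ S, ∀ b, f b < f c → b ∈ S := by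
      intro c hc b hb
      rcases Finset.mem_insert.1 (hT c (Finset.mem_insert_of_mem hc) b hb) with rfl | h
      · exact absurd hb (not_lt.2 (hmax c hc))
      · exact h
    obtain ⟨d, B, hd, hsymm, hB⟩ := ih hS
    -- the vector `u = e_a - w` with `A u = 0` on `S`
    obtain ⟨w, hwS, hwA⟩ : ∃ w : ι → ℝ, (∀ i ∉ S, w i = 0) ∧
        ∀ i ∈ S, A w i = A (Pi.single a 1) i := by
      -- The compression to `S`, completed by the identity off `S`: an injective endomorphism, hence
      -- surjective.
      let φ : (ι → ℝ) →ₗ[ℝ] (ι → ℝ) :=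
        { toFun := fun x i => if i ∈ S then A x i else x i
          map_add' := fun x y => by ext i; by_cases h : i ∈ S <;> simp [h]
          map_smul' := fun c x => by ext i; by_cases h : i ∈ S <;> simp [h] }
      have hφ : Function.Injective φ := by
        rw [injective_iff_map_eq_zero]
        intro x hx
        refine hA S hS x (fun i hi => ?_) fun i hi => ?_
        · simpa [φ, hi] using congrFun hx i
        · simpa [φ, hi] using congrFun hx i
      obtain ⟨w, hw⟩ := (LinearMap.injective_iff_surjective.1 hφ)
        (fun i => if i ∈ S then A (Pi.single a 1) i else 0)
      refine ⟨w, fun i hi => ?_, fun i hi => ?_⟩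
      · simpa [φ, hi] using congrFun hw i
      · simpa [φ, hi] using congrFun hw i
    set u : ι → ℝ := Pi.single a 1 - w with hu
    have hua : u a = 1 := by simp [hu, hwS a haS]
    have huS : ∀ i ∈ S, A u i = 0 := fun i hi => by simp [hu, hwA i hi]
    -- The Schur complement of the new coordinate. Were it zero, `u` would lie in the kernel of the
    -- compression to `insert a S`.
    set s : ℝ := A u a with hs
    have hs0 : s ≠ 0 := by
      intro h0
      have : u = 0 := by
        refine hA (insert a S) hT u (fun i hi => ?_) fun i hi => ?_
        · rw [Finset.mem_insert, not_or] at hi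
          simp [hu, hi.1, hwS i hi.2]
        · rcases Finset.mem_insert.1 hi with rfl | h
          · exact h0
          · exact huS i h
      simp [this] at hua
    let p : Submodule ℝ (ι → ℝ) :=
      { carrier := {x | ∀ i ∉ S, x i = 0}
        add_mem' := fun {x y} hx hy i hi => by simp [hx i hi, hy i hi]
        zero_mem' := fun i _ => rfl
        smul_mem' := fun c x hx i hi => by simp [hx i hi] }
    let DA : (ι → ℝ) →L[ℝ] (ι → ℝ) :=
      ContinuousLinearMap.pi fun i => d i • (ContinuousLinearMap.proj i).comp A
    have hDA : ∀ x, DA x = fun i => d i * A x i := fun x => rfl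
    -- `r` is exactly the loss left after completing the square in `key`.
    obtain ⟨ε, hε, hlt⟩ := exists_pos_mul_lt_of_homogeneous p
      (q := fun x => B x (DA x)) (r := fun x => ((A x a) ^ 2 + (s * B x w) ^ 2) / 2)
      (by fun_prop) (by fun_prop) (fun c x => by simp; ring) (fun c x => by simp; ring)
      (fun x hx hx0 => (hB x hx hx0).2)
    -- The splitting `x = z x + x a • u` has `z x` supported on `S`; in it `A` is block triangular
    -- on the rows of `insert a S`, as `A u` vanishes on `S`.
    let z : (ι → ℝ) →L[ℝ] (ι → ℝ) :=
      ContinuousLinearMap.id ℝ _ - (ContinuousLinearMap.proj a).smulRight u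
    have hz : ∀ x, z x = x - x a • u := fun x => rfl
    -- The gain `ε * s` has the sign of the Schur complement, so the new direction contributes `ε *
    -- (s * x a) ^ 2`; a small `ε` lets the old form absorb the cross terms.
    refine ⟨fun i => if i = a then ε * s else d i,
      B.bilinearComp z z + (ContinuousLinearMap.proj a).smulRight (ContinuousLinearMap.proj a),
      fun i => ?_, fun x y => ?_, fun x hx hx0 => ?_⟩
    · by_cases h : i = a
      · simp [h, hε.ne', hs0]
      · simp [h, hd]
    · simp [hsymm (z x) (z y), mul_comm]
    · have hzS : ∀ i ∉ S, z x i = 0 := by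
        intro i hi
        by_cases h : i = a
        · subst h; simp [hz, hua]
        · have : x i = 0 := hx i (by simp [h, hi])
          simp [hz, hu, h, hwS i hi, this]
      have hxz : x = z x + x a • u := by simp [hz]
      have hcase : z x ≠ 0 ∨ x a ≠ 0 := by
        by_contra! h
        rw [h.1, h.2] at hxz
        exact hx0 (by simpa using hxz)
      have hda : d a = 0 := by
        by_contra h
        exact haS ((hd a).1 h)
      have hAx : ∀ i, A x i = A (z x) i + x a * A u i := fun i => by
        conv_lhs => rw [hxz]
        simp
      have hD : (fun i => (if i = a then ε * s else d i) * A x i) =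
          DA (z x) + (ε * s * (A (z x) a + x a * s)) • Pi.single a (1 : ℝ) := by
        ext i
        by_cases h : i = a
        · subst h; simp [hDA, hda, hAx i, hs]
        · by_cases hi : i ∈ S
          · simp [hDA, h, hAx i, huS i hi]
          · have : d i = 0 := by
              by_contra h'
              exact hi ((hd i).1 h')
            simp [hDA, h, this]
      have hzD : z (DA (z x)) = DA (z x) := by simp [hz, hDA, hda]
      have hze : z (Pi.single a 1) = w := by simp [hz, hu]
      constructor
      · simp only [_root_.add_apply, ContinuousLinearMap.bilinearComp_apply,
          ContinuousLinearMap.smulRight_apply, ContinuousLinearMap.proj_apply,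
          _root_.smul_apply, smul_eq_mul]
        rcases eq_or_ne (z x) 0 with h | h
        · have : x a ≠ 0 := by tauto
          rw [h]; simp only [map_zero]
          have := mul_self_pos.2 this
          simpa using this
        · have := (hB _ hzS h).1
          nlinarith [mul_self_nonneg (x a)]
      · rw [hD]
        simp only [_root_.add_apply, ContinuousLinearMap.bilinearComp_apply,
          ContinuousLinearMap.smulRight_apply, ContinuousLinearMap.proj_apply,
          _root_.smul_apply, smul_eq_mul, map_add, map_smul, hzD, hze]
        have e1 : DA (z x) a = 0 := by simp [hDA, hda]
        simp only [Pi.single_eq_same, e1]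
        set α := A (z x) a
        set β := B (z x) w
        have key : B (z x) (DA (z x)) + x a * 0 + ε * s * (α + x a * s) * (β + x a * 1) =
            (B (z x) (DA (z x)) - ε * ((α ^ 2 + (s * β) ^ 2) / 2)) +
              ε * ((s * x a) ^ 2 / 2 + (s * x a + α + s * β) ^ 2 / 2) := by ring
        rw [key]
        rcases eq_or_ne (z x) 0 with h | h
        · have hxa : x a ≠ 0 := by tauto
          have e2 : α = 0 := by simp [α, h]
          have e3 : β = 0 := by simp [β, h]
          have : 0 < (s * x a) ^ 2 := by positivity
          rw [e2, e3, h]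
          simp only [map_zero]
          have : 0 < ε * ((s * x a) ^ 2 / 2 + (s * x a + 0 + s * 0) ^ 2 / 2) := by positivity
          simpa using this
        · have h1 := hlt (z x) hzS h
          have h2 : 0 ≤ ε * ((s * x a) ^ 2 / 2 + (s * x a + α + s * β) ^ 2 / 2) := by positivity
          exact add_pos_of_pos_of_nonneg (sub_pos.2 h1) h2

/-- A quadratic Lyapunov function gives exponential decay, uniformly over all solutions. -/
theorem exists_exponential_decay_of_lyapunov {ι : Type*} [Fintype ι]
    (K : (ι → ℝ) →L[ℝ] (ι → ℝ)) (B : (ι → ℝ) →L[ℝ] (ι → ℝ) →L[ℝ] ℝ)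
    (hsymm : ∀ x y, B x y = B y x) (hB : ∀ x, x ≠ 0 → 0 < B x x)
    (hK : ∀ x, x ≠ 0 → 0 < B x (K x)) :
    ∃ c rate : ℝ, 0 < c ∧ 0 < rate ∧ ∀ δ : ℝ → ι → ℝ,
      (∀ t, 0 ≤ t → HasDerivWithinAt δ (-(K (δ t))) (Set.Ici 0) t) → ∀ t, 0 ≤ t →
        ‖WithLp.toLp 2 (δ t)‖ ≤ c * Real.exp (-rate * t) * ‖WithLp.toLp 2 (δ 0)‖ := by
  have hN : ∀ x : ι → ℝ, x ≠ 0 → 0 < ‖WithLp.toLp 2 x‖ ^ 2 := fun x hx => by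
    have : WithLp.toLp 2 x ≠ 0 := by simpa using hx
    positivity
  have hNc : Continuous fun x : ι → ℝ => ‖WithLp.toLp 2 x‖ ^ 2 :=
    (PiLp.continuous_toLp 2 _).norm.pow 2
  have hNs : ∀ (a : ℝ) (x : ι → ℝ), ‖WithLp.toLp 2 (a • x)‖ ^ 2 = a ^ 2 * ‖WithLp.toLp 2 x‖ ^ 2 :=
    fun a x => by rw [WithLp.toLp_smul, norm_smul, mul_pow, Real.norm_eq_abs, sq_abs]
  have hBc : Continuous fun x => B x x := by fun_prop
  have hBs : ∀ (a : ℝ) x, B (a • x) (a • x) = a ^ 2 * B x x := fun a x => by simp; ring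
  obtain ⟨m, hm, hmB⟩ := exists_pos_mul_lt_of_homogeneous ⊤ hBc hNc hBs hNs fun x _ => hB x
  obtain ⟨l, hl, hlB⟩ := exists_pos_mul_lt_of_homogeneous ⊤ hNc hBc hNs hBs fun x _ => hN x
  obtain ⟨r, hr, hrB⟩ := exists_pos_mul_lt_of_homogeneous ⊤ (q := fun x => B x (K x))
    (by fun_prop) hBc (fun a x => by simp; ring) hBs fun x _ => hK x
  have hle : ∀ x : ι → ℝ, m * ‖WithLp.toLp 2 x‖ ^ 2 ≤ B x x ∧ l * B x x ≤ ‖WithLp.toLp 2 x‖ ^ 2 ∧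
      r * B x x ≤ B x (K x) := fun x => by
    rcases eq_or_ne x 0 with rfl | hx
    · simp
    · exact ⟨(hmB x trivial hx).le, (hlB x trivial hx).le, (hrB x trivial hx).le⟩
  -- From `m ‖x‖² ≤ B x x ≤ ‖x‖² / l`, together with the decay of `B (δ t) (δ t)` at rate `2 * r`.
  refine ⟨√(1 / (m * l)), r, by positivity, hr, fun δ hδ t ht => ?_⟩
  have hderiv : ∀ t, 0 ≤ t → HasDerivWithinAt (fun τ => Real.exp (2 * r * τ) * B (δ τ) (δ τ))
      (2 * Real.exp (2 * r * t) * (r * B (δ t) (δ t) - B (δ t) (K (δ t)))) (Set.Ici 0) t := by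
    intro t ht
    have h1 : HasDerivWithinAt (fun τ => Real.exp (2 * r * τ))
        (Real.exp (2 * r * t) * (2 * r)) (Set.Ici 0) t := by
      have := ((hasDerivAt_id t).const_mul (2 * r)).exp
      simpa using this.hasDerivWithinAt
    have h2 : HasDerivWithinAt (fun τ => B (δ τ)) (B (-(K (δ t)))) (Set.Ici 0) t :=
      B.hasFDerivAt.comp_hasDerivWithinAt t (hδ t ht)
    have h3 := h1.mul (h2.clm_apply (hδ t ht))
    refine h3.congr_deriv ?_
    simp [hsymm (K (δ t)) (δ t)]
    ring
  have hanti : AntitoneOn (fun τ => Real.exp (2 * r * τ) * B (δ τ) (δ τ)) (Set.Ici 0) := by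
    refine antitoneOn_of_hasDerivWithinAt_nonpos (convex_Ici 0)
      (fun τ hτ => (hderiv τ hτ).continuousWithinAt)
      (fun τ hτ => (hderiv τ (interior_subset hτ)).mono interior_subset) fun τ _ => ?_
    exact mul_nonpos_of_nonneg_of_nonpos (by positivity) (sub_nonpos.2 (hle (δ τ)).2.2)
  have h0 := hanti (Set.mem_Ici.2 le_rfl) (Set.mem_Ici.2 ht) ht
  simp only [mul_zero, Real.exp_zero, one_mul] at h0
  have hexp : Real.exp (2 * r * t) * Real.exp (-r * t) ^ 2 = 1 := by
    rw [← Real.exp_nat_mul, ← Real.exp_add]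
    simp; ring
  refine (sq_le_sq₀ (norm_nonneg _) (by positivity)).1 ?_
  rw [mul_pow, mul_pow, Real.sq_sqrt (by positivity)]
  have h1 := (hle (δ t)).1
  have h2 := (hle (δ 0)).2.1
  have hBt : B (δ t) (δ t) ≤ Real.exp (-r * t) ^ 2 * B (δ 0) (δ 0) := by
    calc B (δ t) (δ t) = Real.exp (-r * t) ^ 2 * (Real.exp (2 * r * t) * B (δ t) (δ t)) := by
          rw [← mul_assoc, mul_comm (_ ^ 2), hexp, one_mul]
      _ ≤ _ := by gcongr
  have h3 : m * l * ‖WithLp.toLp 2 (δ t)‖ ^ 2 ≤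
      Real.exp (-r * t) ^ 2 * ‖WithLp.toLp 2 (δ 0)‖ ^ 2 := by
    calc m * l * ‖WithLp.toLp 2 (δ t)‖ ^ 2 = l * (m * ‖WithLp.toLp 2 (δ t)‖ ^ 2) := by ring
      _ ≤ l * (Real.exp (-r * t) ^ 2 * B (δ 0) (δ 0)) := 
          mul_le_mul_of_nonneg_left (h1.trans hBt) hl.le
      _ = Real.exp (-r * t) ^ 2 * (l * B (δ 0) (δ 0)) := by ring
      _ ≤ _ := by gcongr
  rw [mul_assoc, one_div, le_inv_mul_iff₀ (by positivity)]
  exact h3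

/-- Linear systems with constant coefficients have global solutions. -/
theorem exists_linear_solution {E : Type*} [NormedAddCommGroup E] [NormedSpace ℝ E]
    [CompleteSpace E] (K : E →L[ℝ] E) (x₀ : E) :
    ∃ x : ℝ → E, x 0 = x₀ ∧ ∀ t, HasDerivAt x (-(K (x t))) t := by
  refine ⟨fun t => NormedSpace.exp (t • (-K)) x₀, by simp, fun t => ?_⟩
  have h := (hasDerivAt_exp_smul_const' (𝕂 := ℝ) (-K) t).clm_apply (hasDerivAt_const t x₀)
  simpa using h

/-! ### The collinearity recursion along a path -/

/-- Along a path whose consecutive points satisfy the collinearity relations up to some place and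
whose values vanish beyond it, all values vanish. -/
theorem path_values_eq_zero {l : ℕ} {y ξ : ℕ → ℝ} {p : ℕ → Prop}
    (hp : ∀ j k, 1 ≤ j → j ≤ k → k ≤ l → p k → p j)
    (hstep : ∀ j, 1 ≤ j → j < l → y (j + 1) ≠ y j)
    (hbase : ∀ j, 2 ≤ j → j ≤ l + 1 → y j ≠ y 0)
    (h0 : ξ 0 = 0) (hl : ξ (l + 1) = 0)
    (hrow : ∀ j, j + 1 ≤ l → p (j + 1) → (y (j + 2) - y (j + 1)) * ξ j +
      (y (j + 1) - y j) * ξ (j + 2) + (y j - y (j + 2)) * ξ (j + 1) = 0)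
    (hout : ∀ j, 1 ≤ j → j ≤ l → ¬ p j → ξ j = 0) :
    ∀ j, j ≤ l + 1 → ξ j = 0 := by
  -- The points at `j` and `j + 1` are collinear with `(y 0, 0)`.
  have hdet : ∀ j, j ≤ l → (1 ≤ j → p j) →
      (y j - y 0) * ξ (j + 1) = (y (j + 1) - y 0) * ξ j := by
    intro j
    induction j with
    | zero => simp [h0]
    | succ j ih =>
      intro hj hpj
      have hpj' := hpj (by omega)
      have hr := hrow j hj hpj'
      -- At the first inner agent the row is already the claim, so `y 1 ≠ y 0` is never needed;
      -- later steps cancel `y (j + 1) - y j`.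
      rcases Nat.eq_zero_or_pos j with rfl | hj0
      · rw [h0] at hr
        simp only [zero_add] at hr ⊢
        linarith
      · have hi := ih (by omega) fun _ => hp j (j + 1) hj0 (by omega) hj hpj'
        have hne := sub_ne_zero.2 (hstep j hj0 hj)
        refine mul_left_cancel₀ hne ?_
        linear_combination (y (j + 1) - y 0) * hr + (y (j + 2) - y (j + 1)) * hi
  intro j hj
  rcases Nat.eq_zero_or_pos j with rfl | hj0
  · exact h0
  clear h0
  -- Backwards: rows outside `p` have value zero by hypothesis, and inside `p` a zero at `j + 1`
  -- passes to `j` because `y (j + 1) ≠ y 0`.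
  induction hj using Nat.decreasingInduction with
  | self => exact hl
  | of_succ j hj ih =>
    by_cases hpj : p j
    · have := hdet j (by omega) fun _ => hpj
      rw [ih (by omega), mul_zero] at this
      exact (mul_eq_zero.1 this.symm).resolve_left (sub_ne_zero.2 (hbase _ (by omega) (by omega)))
    · exact hout j hj0 (by omega) hpj

/-! ### The agents along a dual-entry path -/

/-- The agents of a dual-entry path in order: the entry `entryI` at `0`, the inner agents at
`1, …, len`, and the entry `entryJ` from `len + 1` on. -/
def DEP.point {V : Type*} (P : DEP V) : ℕ → V
  | 0 => P.entryI
  | m + 1 => if h : m < P.len then P.inner ⟨m, h⟩ else P.entryJ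

theorem DEP.point_inner {V : Type*} (P : DEP V) {m : ℕ} (h : m < P.len) :
    P.point (m + 1) = P.inner ⟨m, h⟩ := by simp [DEP.point, h]

theorem DEP.point_last {V : Type*} (P : DEP V) : P.point (P.len + 1) = P.entryJ := by
  simp [DEP.point]

theorem DEP.point_eq_last {V : Type*} (P : DEP V) {m : ℕ} (h : ¬ m < P.len) :
    P.point (m + 1) = P.entryJ := by
  simp [DEP.point, h]

/-- An inner agent of a dual-entry path measures exactly its predecessor and its successor. -/
theorem DEP.edge_inner_iff {V : Type*} (P : DEP V) {u : V} {m : ℕ} (h : m < P.len) :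
    P.Edge u (P.inner ⟨m, h⟩) ↔ u = P.point m ∨ u = P.point (m + 2) := by
  unfold DEP.Edge
  constructor
  · rintro (⟨rfl, h1⟩ | ⟨rfl, h1⟩ | ⟨r, s, hrs, rfl, h1⟩)
    · have := congrArg Fin.val (P.inner_injective h1)
      left
      simp only at this
      subst this
      rfl
    · have := congrArg Fin.val (P.inner_injective h1)
      simp only at this
      right
      rw [P.point_eq_last (by omega)]
    · have := congrArg Fin.val (P.inner_injective h1)
      simp only at this
      rcases hrs with hrs | hrs
      · left
        obtain rfl : m = r + 1 := by omega
        exact (P.point_inner r.2).symm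
      · right
        have hr : (r : ℕ) = m + 1 := by omega
        rw [P.point_inner (m := m + 1) (hr ▸ r.2)]
        exact congrArg P.inner (Fin.ext hr)
  · rintro (rfl | rfl)
    · rcases m with _ | m
      · exact Or.inl ⟨rfl, rfl⟩
      · right; right
        exact ⟨⟨m, by omega⟩, ⟨m + 1, h⟩, Or.inl rfl, P.point_inner _, rfl⟩
    · right
      by_cases hm : m + 1 < P.len
      · right
        exact ⟨⟨m + 1, hm⟩, ⟨m, h⟩, Or.inr rfl, P.point_inner hm, rfl⟩
      · left
        refine ⟨P.point_eq_last hm, ?_⟩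
        congr 2
        omega

theorem DEP.exists_inner_of_edge {V : Type*} (P : DEP V) {u v : V} (h : P.Edge u v) :
    ∃ r, v = P.inner r := by
  rcases h with ⟨_, h⟩ | ⟨_, h⟩ | ⟨r, s, _, _, h⟩
  exacts [⟨_, h⟩, ⟨_, h⟩, ⟨_, h⟩]

theorem DEP.inner_mem_verts {V : Type*} (P : DEP V) (r : Fin P.len) : P.inner r ∈ P.verts :=
  Or.inr ⟨r, rfl⟩

theorem DEP.point_ne_point_add_two {V : Type*} (P : DEP V) {m : ℕ} (h : m < P.len) :
    P.point m ≠ P.point (m + 2) := by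
  by_cases hm : m + 1 < P.len
  · rw [P.point_inner hm]
    rcases m with _ | m
    · exact (P.inner_ne_entryI _).symm
    · rw [P.point_inner (by omega)]
      intro h'
      have := congrArg Fin.val (P.inner_injective h')
      simp only at this
      omega
  · rw [P.point_eq_last hm]
    rcases m with _ | m
    · exact P.entry_ne
    · rw [P.point_inner (by omega)]
      exact P.inner_ne_entryJ _

theorem DEP.point_ne_inner {V : Type*} (P : DEP V) {m : ℕ} (h : m < P.len) :
    P.point m ≠ P.inner ⟨m, h⟩ := by
  rcases m with _ | m
  · exact (P.inner_ne_entryI _).symm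
  · rw [P.point_inner (by omega)]
    intro h'
    have := congrArg Fin.val (P.inner_injective h')
    simp at this

theorem DEP.point_add_two_ne_inner {V : Type*} (P : DEP V) {m : ℕ} (h : m < P.len) :
    P.point (m + 2) ≠ P.inner ⟨m, h⟩ := by
  by_cases hm : m + 1 < P.len
  · rw [P.point_inner hm]
    intro h'
    have := congrArg Fin.val (P.inner_injective h')
    simp at this
  · rw [P.point_eq_last hm]
    exact (P.inner_ne_entryJ _).symm

/-! ### Followers as inner agents -/

namespace DEPInduced

variable {n : ℕ} (L : DEPInduced n)

theorem entry_mem (h : Fin L.κ) {v : Fin n}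
    (hv : v = (L.dep h).entryI ∨ v = (L.dep h).entryJ) :
    (v : ℕ) < 2 ∨ ∃ h' < h, v ∈ (L.dep h').verts := by
  have hmem : v ∈ ({(L.dep h).entryI, (L.dep h).entryJ} : Set (Fin n)) := hv
  rw [← L.attach h] at hmem
  simpa using hmem.2

theorem inner_not_mem (h : Fin L.κ) (r : Fin (L.dep h).len) :
    2 ≤ ((L.dep h).inner r : ℕ) ∧ ∀ h' < h, (L.dep h).inner r ∉ (L.dep h').verts := by
  have hn : (L.dep h).inner r ∉ ({(L.dep h).entryI, (L.dep h).entryJ} : Set (Fin n)) := by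
    rintro (h' | h')
    · exact (L.dep h).inner_ne_entryI r h'
    · exact (L.dep h).inner_ne_entryJ r h'
  rw [← L.attach h] at hn
  constructor
  · by_contra hlt
    exact hn ⟨(L.dep h).inner_mem_verts r, Or.inl (by simpa using hlt)⟩
  · intro h' hh' hmem
    exact hn ⟨(L.dep h).inner_mem_verts r, Or.inr (by simpa using ⟨h', hh', hmem⟩)⟩

/-- Otherwise the later of the two paths would meet the earlier one outside its own entries. -/
theorem inner_unique {h h' : Fin L.κ} {r : Fin (L.dep h).len} {r' : Fin (L.dep h').len}
    (e : (L.dep h).inner r = (L.dep h').inner r') : h = h' := by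
  rcases lt_trichotomy h h' with hlt | rfl | hlt
  · exact absurd (e ▸ (L.dep h).inner_mem_verts r) ((L.inner_not_mem h' r').2 h hlt)
  · rfl
  · exact absurd (e ▸ (L.dep h').inner_mem_verts r') ((L.inner_not_mem h r).2 h' hlt)

/-- Every edge ends at an inner agent of its own path, so later paths attached at this agent add no
measurement to it. -/
theorem edge_inner_iff (h : Fin L.κ) {m : ℕ} (hm : m < (L.dep h).len) (u : Fin n) :
    L.Edge u ((L.dep h).inner ⟨m, hm⟩) ↔
      u = (L.dep h).point m ∨ u = (L.dep h).point (m + 2) := by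
  rw [← DEP.edge_inner_iff _ hm]
  constructor
  · rintro ⟨h', he⟩
    obtain ⟨r, hr⟩ := (L.dep h').exists_inner_of_edge he
    obtain rfl := L.inner_unique hr
    exact he
  · exact fun he => ⟨h, he⟩

/-- Descent on the path index: an entry that is not a leader already belongs to an earlier path. -/
theorem exists_inner_of_mem_verts (h : Fin L.κ) {k : Fin n} (hk : 2 ≤ (k : ℕ))
    (hmem : k ∈ (L.dep h).verts) :
    ∃ h' : Fin L.κ, ∃ m, ∃ hm : m < (L.dep h').len, (L.dep h').inner ⟨m, hm⟩ = k := by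
  induction h using WellFoundedLT.induction with
  | ind h ih =>
    rcases hmem with hmem | ⟨r, hr⟩
    · rcases L.entry_mem h hmem with hlt | ⟨h', hh', hv⟩
      · omega
      · exact ih h' hh' hv
    · exact ⟨h, r, r.2, hr⟩

theorem exists_inner (hL : L.verts = Set.univ) {k : Fin n} (hk : 2 ≤ (k : ℕ)) :
    ∃ h : Fin L.κ, ∃ m, ∃ hm : m < (L.dep h).len, (L.dep h).inner ⟨m, hm⟩ = k := by
  have hmem : k ∈ L.verts := hL ▸ Set.mem_univ k
  rcases hmem with hlt | hmem
  · exact absurd hlt (not_lt.2 hk)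
  · obtain ⟨h, hv⟩ := Set.mem_iUnion.1 hmem
    exact L.exists_inner_of_mem_verts h hk hv

end DEPInduced

/-! ### Rows of the Laplacian -/

/-- The nominal state in the rotated coordinates. -/
noncomputable def rotatedNominal {n : ℕ} (gt : Fin n → Fin 3 → ℝ) (θ : ℝ) (u : Fin n) : Fin 3 → ℝ :=
  (Theta θ)ᵀ *ᵥ gt u

theorem nominalDiff_apply {n : ℕ} (gt : Fin n → Fin 3 → ℝ) (θ : ℝ) (u v : Fin n) (c : Fin 3) :
    nominalDiff gt θ u v c = rotatedNominal gt θ u c - rotatedNominal gt θ v c := rfl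

theorem Theta_transpose_mul (θ : ℝ) : (Theta θ)ᵀ * Theta θ = 1 := by
  ext i j
  have := Real.sin_sq_add_cos_sq θ
  fin_cases i <;> fin_cases j <;> simp [Theta, Matrix.mul_apply, Fin.sum_univ_three] <;>
    linarith

theorem diagTheta_transpose_mul (ι : Type*) [Fintype ι] [DecidableEq ι] (θ : ℝ) :
    (diagTheta ι θ)ᵀ * diagTheta ι θ = 1 := by
  rw [diagTheta, ← Matrix.kroneckerMap_transpose, ← Matrix.mul_kronecker_mul,
    Theta_transpose_mul]
  simp

theorem diagTheta_transpose_mulVec (ι : Type*) [Fintype ι] [DecidableEq ι] (θ : ℝ)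
    (x : ι × Fin 3 → ℝ) (i : ι) (c : Fin 3) :
    ((diagTheta ι θ)ᵀ *ᵥ x) (i, c) = ((Theta θ)ᵀ *ᵥ fun b => x (i, b)) c := by
  simp [diagTheta, Matrix.mulVec, dotProduct, Fintype.sum_prod_type, Matrix.one_apply, ite_mul]

theorem laplacianHat_apply {n : ℕ} (E : Fin n → Fin n → Prop) (gt : Fin n → Fin 3 → ℝ) (θ : ℝ)
    (k i : Fin n) (c b : Fin 3) :
    laplacianHat E gt θ (k, c) (i, b) = (laplacianBlock E gt θ k i * Theta θ) c b := by
  simp [laplacianHat, laplacian, diagTheta, Matrix.mul_apply, Fintype.sum_prod_type,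
    Matrix.one_apply, mul_ite]

theorem WMat_mul_Theta {n : ℕ} (gt : Fin n → Fin 3 → ℝ) (θ : ℝ) (i j : Fin n) :
    WMat gt θ i j * Theta θ = Matrix.diagonal (nominalDiff gt θ i j) := by
  rw [WMat, Matrix.mul_assoc, Theta_transpose_mul, Matrix.mul_one, wMat]

/-- Two measured agents leave `(p, q, k)` as the only constraint at `k`, and the factor `Θ` in `M̂`
cancels the `Θᵀ` in each weight. -/
theorem laplacianHat_mulVec_of_lt {n : ℕ} {E : Fin n → Fin n → Prop} (gt : Fin n → Fin 3 → ℝ)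
    (θ : ℝ) {p q k : Fin n} (hpq : p < q) (hpk : p ≠ k) (hqk : q ≠ k)
    (hE : ∀ u, E u k ↔ u = p ∨ u = q) (x : Fin n × Fin 3 → ℝ) (c : Fin 3) :
    (laplacianHat E gt θ *ᵥ x) (k, c) =
      nominalDiff gt θ q k c * x (p, c) + nominalDiff gt θ k p c * x (q, c) +
        nominalDiff gt θ p q c * x (k, c) := by
  classical
  have hC : ∀ a b, IsConstraint E a b k ↔ a = p ∧ b = q := by
    intro a b
    simp only [IsConstraint, hE]
    constructor
    · rintro ⟨rfl | rfl, rfl | rfl, h⟩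
      · exact absurd h (lt_irrefl _)
      · exact ⟨rfl, rfl⟩
      · exact absurd h (lt_asymm hpq)
      · exact absurd h (lt_irrefl _)
    · rintro ⟨rfl, rfl⟩
      exact ⟨Or.inl rfl, Or.inr rfl, hpq⟩
  have hblock : ∀ i, laplacianBlock E gt θ k i * Theta θ =
      (if i = k then Matrix.diagonal (nominalDiff gt θ p q) else 0) +
      (if i = p then Matrix.diagonal (nominalDiff gt θ q k) else 0) +
      (if i = q then Matrix.diagonal (nominalDiff gt θ k p) else 0) := by
    intro i
    simp only [laplacianBlock, hC, ← WMat_mul_Theta]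
    by_cases hik : k = i
    · subst hik
      simp [ite_and, hpk.symm, hqk.symm]
    · by_cases hip : i = p
      · subst hip
        simp [hik, hpq.ne, hpk]
      · by_cases hiq : i = q
        · subst hiq
          simp [hik, hip, hqk]
        · simp [hik, hip, hiq, Ne.symm hik]
  simp only [Matrix.mulVec, dotProduct, Fintype.sum_prod_type, laplacianHat_apply, hblock,
    Matrix.add_apply, add_mul, Finset.sum_add_distrib]
  have haux : ∀ (a : Fin n) (v : Fin 3 → ℝ),
      ∑ i, ∑ b, (if i = a then Matrix.diagonal v else 0) c b * x (i, b) = v c * x (a, c) := by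
    intro a v
    rw [Finset.sum_eq_single a (fun i _ hi => by simp [hi]) (by simp)]
    simp [Matrix.diagonal_apply, ite_mul]
  rw [haux, haux, haux]
  ring

/-- If `k` measures exactly `p` and `q`, then its row of `M̂` is, up to sign, the collinearity
relation between `p`, `k` and `q`. -/
theorem laplacianHat_mulVec_eq_zero_iff {n : ℕ} {E : Fin n → Fin n → Prop}
    (gt : Fin n → Fin 3 → ℝ) (θ : ℝ) {p q k : Fin n} (hpq : p ≠ q) (hpk : p ≠ k) (hqk : q ≠ k)
    (hE : ∀ u, E u k ↔ u = p ∨ u = q) (x : Fin n × Fin 3 → ℝ) (c : Fin 3) :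
    (laplacianHat E gt θ *ᵥ x) (k, c) = 0 ↔
      nominalDiff gt θ q k c * x (p, c) + nominalDiff gt θ k p c * x (q, c) +
        nominalDiff gt θ p q c * x (k, c) = 0 := by
  rcases lt_or_gt_of_ne hpq with h | h
  · rw [laplacianHat_mulVec_of_lt gt θ h hpk hqk hE]
  · rw [laplacianHat_mulVec_of_lt gt θ h hqk hpk (fun u => (hE u).trans or_comm), ← neg_eq_zero]
    simp only [nominalDiff_apply]
    constructor <;> intro h' <;> linear_combination h'

theorem laplacianHat_mulVec_follower {n : ℕ} (E : Fin n → Fin n → Prop) (gt : Fin n → Fin 3 → ℝ)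
    (θ : ℝ) (x : Fin n × Fin 3 → ℝ) (k : Follower n) (c : Fin 3) :
    (laplacianHat E gt θ *ᵥ x) (k.1, c) =
      (hatFF E gt θ *ᵥ followerPart x) (k, c) + (hatFL E gt θ *ᵥ leaderPart x) (k, c) := by
  simp only [Matrix.mulVec, dotProduct, Fintype.sum_prod_type, hatFF, hatFL, Matrix.submatrix_apply,
    followerPart, leaderPart]
  rw [add_comm, ← Fintype.sum_subtype_add_sum_subtype (fun i : Fin n => (i : ℕ) < 2)]
  congr 1
  exact Fintype.sum_equiv (Equiv.subtypeEquivRight fun i => not_lt) _ _ fun i => rfl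

/-! ### Injectivity of the compressions of `M̂_ff` -/

/-- The extension of a follower vector by zero at the leaders. -/
def extendFollower {n : ℕ} (x : Follower n × Fin 3 → ℝ) : Fin n × Fin 3 → ℝ :=
  fun p => if h : 2 ≤ (p.1 : ℕ) then x (⟨p.1, h⟩, p.2) else 0

theorem hatFF_mulVec {n : ℕ} (E : Fin n → Fin n → Prop) (gt : Fin n → Fin 3 → ℝ) (θ : ℝ)
    (x : Follower n × Fin 3 → ℝ) (k : Follower n) (c : Fin 3) :
    (hatFF E gt θ *ᵥ x) (k, c) = (laplacianHat E gt θ *ᵥ extendFollower x) (k.1, c) := by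
  have h1 : followerPart (extendFollower x) = x := by
    ext p
    simp [followerPart, extendFollower, p.1.2]
  have h2 : leaderPart (extendFollower x) = 0 := by
    ext p
    simp [leaderPart, extendFollower, not_le.2 p.1.2]
  rw [laplacianHat_mulVec_follower, h1, h2, Matrix.mulVec_zero]
  simp

/-- A follower vector supported on a set of rows that is closed under going to earlier agents of
the construction, and annihilated by these rows of `M̂_ff`, is zero. -/
theorem eq_zero_of_hatFF_mulVec_eq_zero {n : ℕ} (L : DEPInduced n)
    (gt : Fin n → Fin 3 → ℝ) (θ : ℝ) (hrank : RankAssumption L gt θ)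
    (hstab : StabilityAssumption L gt θ) (hh : Follower n → Fin L.κ) (mm : Follower n → ℕ)
    (hlt : ∀ k, mm k < (L.dep (hh k)).len)
    (hin : ∀ k, (L.dep (hh k)).inner ⟨mm k, hlt k⟩ = k.1)
    (S : Finset (Follower n × Fin 3))
    (hS : ∀ a ∈ S, ∀ b : Follower n × Fin 3,
      toLex (hh b.1, mm b.1) < toLex (hh a.1, mm a.1) → b ∈ S)
    (x : Follower n × Fin 3 → ℝ) (hx : ∀ i ∉ S, x i = 0)
    (hrow : ∀ i ∈ S, (hatFF L.Edge gt θ *ᵥ x) i = 0) : x = 0 := by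
  have hlead : ∀ (v : Fin n) c, (v : ℕ) < 2 → extendFollower x (v, c) = 0 := fun v c hv => by
    simp [extendFollower, not_le.2 hv]
  -- The chosen place `(hh k, mm k)` of a follower is its only place as an inner agent.
  have hloc : ∀ (h : Fin L.κ) (m : ℕ) (hm : m < (L.dep h).len)
      (hk : 2 ≤ ((L.dep h).inner ⟨m, hm⟩ : ℕ)),
      hh ⟨(L.dep h).inner ⟨m, hm⟩, hk⟩ = h ∧ mm ⟨(L.dep h).inner ⟨m, hm⟩, hk⟩ = m := by
    intro h m hm hk
    have e := hin ⟨(L.dep h).inner ⟨m, hm⟩, hk⟩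
    have e1 := L.inner_unique e
    generalize hlt ⟨(L.dep h).inner ⟨m, hm⟩, hk⟩ = hlt' at e
    generalize mm ⟨(L.dep h).inner ⟨m, hm⟩, hk⟩ = m' at *
    generalize hh ⟨(L.dep h).inner ⟨m, hm⟩, hk⟩ = h' at *
    subst e1
    exact ⟨rfl, congrArg Fin.val ((L.dep h').inner_injective e)⟩
  have main : ∀ (c : Fin 3) (h : Fin L.κ), ∀ v ∈ (L.dep h).verts,
      extendFollower x (v, c) = 0 := by
    intro c h
    induction h using WellFoundedLT.induction with
    | ind h ih =>
      have hentry : ∀ v, v = (L.dep h).entryI ∨ v = (L.dep h).entryJ →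
          extendFollower x (v, c) = 0 := by
        intro v hv
        rcases L.entry_mem h hv with hv | ⟨h', hh', hv⟩
        · exact hlead v c hv
        · exact ih h' hh' v hv
      set P := L.dep h with hP
      have hfol : ∀ m (hm : m < P.len), 2 ≤ (P.inner ⟨m, hm⟩ : ℕ) := fun m hm =>
        (L.inner_not_mem h ⟨m, hm⟩).1
      have hlocP : ∀ (m : ℕ) (hm : m < P.len) (hk : 2 ≤ (P.inner ⟨m, hm⟩ : ℕ)),
          hh ⟨P.inner ⟨m, hm⟩, hk⟩ = h ∧ mm ⟨P.inner ⟨m, hm⟩, hk⟩ = m := hloc h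
      have hpt : ∀ j, j ≤ P.len + 1 → extendFollower x (P.point j, c) = 0 := by
        -- Position `j` holds the inner agent `j - 1`, and `p j` says that its component `c` is
        -- among the rows kept. Membership depends on `c`, since `S` may contain only some
        -- components of an agent at its top level.
        refine path_values_eq_zero (l := P.len) (y := fun j => rotatedNominal gt θ (P.point j) c)
          (p := fun j => ∃ (hm : j - 1 < P.len), ((⟨P.inner ⟨j - 1, hm⟩, hfol _ hm⟩, c) :
            Follower n × Fin 3) ∈ S) ?_ ?_ ?_ ?_ ?_ ?_ ?_
        · rintro j k hj hjk hk ⟨hm, hmem⟩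
          rcases hjk.eq_or_lt with rfl | hjk
          · exact ⟨hm, hmem⟩
          refine ⟨by omega, hS _ hmem _ ?_⟩
          rw [Prod.Lex.toLex_lt_toLex]
          right
          obtain ⟨e1, e2⟩ := hlocP (j - 1) (by omega) (hfol _ (by omega))
          obtain ⟨e3, e4⟩ := hlocP (k - 1) (by omega) (hfol _ (by omega))
          exact ⟨e1.trans e3.symm, lt_of_eq_of_lt e2 (lt_of_lt_of_eq (by omega) e4.symm)⟩
        · intro j hj hjl
          obtain ⟨m, rfl⟩ : ∃ m, j = m + 1 := ⟨j - 1, by omega⟩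
          have e := hrank h (P.point (m + 2)) (P.point (m + 1)) (Or.inl ⟨?_, ?_⟩)
          · exact sub_ne_zero.1 (Finset.prod_ne_zero_iff.1 e c (Finset.mem_univ c))
          · rw [P.point_inner (m := m) (by omega), ← hP, P.edge_inner_iff]
            exact Or.inr rfl
          · rw [P.point_inner (m := m + 1) (by omega), ← hP, P.edge_inner_iff]
            exact Or.inl rfl
        · intro j hj hjl
          obtain ⟨m, rfl⟩ : ∃ m, j = m + 1 := ⟨j - 1, by omega⟩
          -- An inner agent here is where a truncated path may end, covered by `hstab`; the far
          -- entry is covered by `hrank`.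
          by_cases hm : m < P.len
          · have e := hstab h ⟨m, hm⟩ (by simp only; omega)
            have := sub_ne_zero.1 (Finset.prod_ne_zero_iff.1 e c (Finset.mem_univ c))
            simp only [P.point_inner hm]
            exact this.symm
          · have e := hrank h P.entryI P.entryJ (Or.inr ⟨rfl, rfl⟩)
            have := sub_ne_zero.1 (Finset.prod_ne_zero_iff.1 e c (Finset.mem_univ c))
            simp only [P.point_eq_last hm]
            exact this.symm
        · exact hentry _ (Or.inl rfl)
        · exact hentry _ (Or.inr P.point_last)
        · rintro j hj ⟨hm, hmem⟩
          have hj' : j < P.len := hj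
          have e := hrow _ hmem
          rw [hatFF_mulVec] at e
          have e' := (laplacianHat_mulVec_eq_zero_iff gt θ (P.point_ne_point_add_two hj')
            (P.point_ne_inner hj') (P.point_add_two_ne_inner hj')
            (L.edge_inner_iff h hj') _ c).1 e
          rw [P.point_inner hj']
          exact e'
        · intro j hj hjl hnot
          obtain ⟨m, rfl⟩ : ∃ m, j = m + 1 := ⟨j - 1, by omega⟩
          have hm : m < P.len := hjl
          rw [P.point_inner hm]
          simp only [extendFollower, hfol m hm, dif_pos]
          exact hx _ fun hmem => hnot ⟨hm, hmem⟩
      rintro v (hv | ⟨r, rfl⟩)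
      · exact hentry v hv
      · have := hpt (r + 1) (by omega)
        rwa [P.point_inner r.2] at this
  ext ⟨k, c⟩
  have := main c (hh k) k.1 (hin k ▸ (L.dep (hh k)).inner_mem_verts _)
  simpa [extendFollower, k.2] using this

/-! ### The target configuration -/

/-- In rotated coordinates each component of the target is an affine function of the nominal one,
and collinearity relations annihilate affine functions. -/
theorem laplacianHat_mulVec_affine {n : ℕ} {E : Fin n → Fin n → Prop} (gt : Fin n → Fin 3 → ℝ)
    (θ : ℝ) (s τ : Fin 3 → ℝ) {p q k : Fin n} (hpq : p ≠ q) (hpk : p ≠ k) (hqk : q ≠ k)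
    (hE : ∀ u, E u k ↔ u = p ∨ u = q) (c : Fin 3) :
    (laplacianHat E gt θ *ᵥ ((diagTheta (Fin n) θ)ᵀ *ᵥ targetState gt θ s τ)) (k, c) = 0 := by
  have ht : ∀ u, ((diagTheta (Fin n) θ)ᵀ *ᵥ targetState gt θ s τ) (u, c) =
      s c * rotatedNominal gt θ u c + ((Theta θ)ᵀ *ᵥ τ) c := by
    intro u
    have e : (fun b => targetState gt θ s τ (u, b)) =
        (Theta θ * Matrix.diagonal s * (Theta θ)ᵀ) *ᵥ gt u + τ := rfl
    rw [diagTheta_transpose_mulVec, e, Matrix.mulVec_add, Matrix.mulVec_mulVec, ← Matrix.mul_assoc,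
      ← Matrix.mul_assoc, Theta_transpose_mul, Matrix.one_mul, ← Matrix.mulVec_mulVec,
      Pi.add_apply, Matrix.mulVec_diagonal]
    rfl
  rw [laplacianHat_mulVec_eq_zero_iff gt θ hpq hpk hqk hE, ht, ht, ht]
  simp only [nominalDiff_apply]
  ring

theorem followerPart_diagTheta_transpose_mulVec {n : ℕ} (θ : ℝ) (g : Fin n × Fin 3 → ℝ) :
    followerPart ((diagTheta (Fin n) θ)ᵀ *ᵥ g) =
      (diagTheta (Follower n) θ)ᵀ *ᵥ followerPart g := by
  ext ⟨k, c⟩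
  rw [diagTheta_transpose_mulVec]
  exact diagTheta_transpose_mulVec (Fin n) θ g k.1 c

theorem leaderPart_diagTheta_transpose_mulVec {n : ℕ} (θ : ℝ) (g : Fin n × Fin 3 → ℝ) :
    leaderPart ((diagTheta (Fin n) θ)ᵀ *ᵥ g) =
      (diagTheta (Leader n) θ)ᵀ *ᵥ leaderPart g := by
  ext ⟨k, c⟩
  rw [diagTheta_transpose_mulVec]
  exact diagTheta_transpose_mulVec (Fin n) θ g k.1 c

/-- A state annihilated by the follower rows of `M` has the follower target determined by its
leader part. -/
theorem followerTarget_eq_followerPart {n : ℕ} (E : Fin n → Fin n → Prop) (gt : Fin n → Fin 3 → ℝ)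
    (θ : ℝ) (hdet : (hatFF E gt θ).det ≠ 0) (g : Fin n × Fin 3 → ℝ)
    (hg : ∀ (k : Follower n) c,
      (laplacianHat E gt θ *ᵥ ((diagTheta (Fin n) θ)ᵀ *ᵥ g)) (k.1, c) = 0) :
    followerTarget E gt θ (leaderPart g) = followerPart g := by
  have hunit : IsUnit (hatFF E gt θ * (diagTheta (Follower n) θ)ᵀ).det := by
    have h1 := congrArg Matrix.det (diagTheta_transpose_mul (Follower n) θ)
    rw [Matrix.det_mul, Matrix.det_one] at h1
    rw [Matrix.det_mul, isUnit_iff_ne_zero]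
    exact mul_ne_zero hdet (left_ne_zero_of_mul_eq_one h1)
  have hsum : (hatFF E gt θ * (diagTheta (Follower n) θ)ᵀ) *ᵥ followerPart g +
      (hatFL E gt θ * (diagTheta (Leader n) θ)ᵀ) *ᵥ leaderPart g = 0 := by
    ext ⟨k, c⟩
    have := hg k c
    rw [laplacianHat_mulVec_follower, followerPart_diagTheta_transpose_mulVec,
      leaderPart_diagTheta_transpose_mulVec, Matrix.mulVec_mulVec, Matrix.mulVec_mulVec] at this
    exact this
  rw [followerTarget, eq_neg_of_add_eq_zero_right hsum, Matrix.mulVec_neg, neg_neg,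
    Matrix.mulVec_mulVec, Matrix.nonsing_inv_mul _ hunit, Matrix.one_mulVec]

/-! ### Trajectories -/

/-- The linear part of the closed loop. -/
noncomputable def closedLoop {n : ℕ} (E : Fin n → Fin n → Prop) (gt : Fin n → Fin 3 → ℝ) (θ : ℝ)
    (d : Follower n → Fin 3 → ℝ) : (Follower n × Fin 3 → ℝ) →L[ℝ] (Follower n × Fin 3 → ℝ) :=
  (diagTheta (Follower n) θ * Matrix.diagonal (fun p : Follower n × Fin 3 => d p.1 p.2) *
    hatFF E gt θ * (diagTheta (Follower n) θ)ᵀ).mulVecLin.toContinuousLinearMap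

/-- The error obeys an autonomous linear equation; its solution plus the constant follower target is
glued to the frozen leaders. -/
theorem exists_isStationaryLeaderTrajectory {n : ℕ} (E : Fin n → Fin n → Prop)
    (gt : Fin n → Fin 3 → ℝ) (θ : ℝ) (d : Follower n → Fin 3 → ℝ) (g₀ : Fin n × Fin 3 → ℝ) :
    ∃ g : ℝ → Fin n × Fin 3 → ℝ, g 0 = g₀ ∧
      IsStationaryLeaderTrajectory E gt θ d (leaderPart g₀) g := by
  obtain ⟨δ, hδ0, hδ⟩ := exists_linear_solution (closedLoop E gt θ d)
    (trackingError E gt θ (leaderPart g₀) g₀)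
  let g : ℝ → Fin n × Fin 3 → ℝ := fun t p =>
    if h : 2 ≤ (p.1 : ℕ) then
      (δ t + followerTarget E gt θ (leaderPart g₀)) (⟨p.1, h⟩, p.2) else g₀ p
  have hf : ∀ t, followerPart (g t) = δ t + followerTarget E gt θ (leaderPart g₀) := fun t => by
    ext p
    simp [followerPart, g, p.1.2]
  have hl : ∀ t, leaderPart (g t) = leaderPart g₀ := fun t => by
    ext p
    simp [leaderPart, g, not_le.2 p.1.2]
  refine ⟨g, ?_, fun t _ => hl t, fun t _ => ?_, fun t _ => ?_⟩
  · ext p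
    by_cases h : 2 ≤ (p.1 : ℕ)
    · simp [g, h, hδ0, trackingError, followerPart]
    · simp [g, h]
  · simp only [hl]
    exact hasDerivWithinAt_const _ _ _
  · simp only [hf, trackingError, add_sub_cancel_right]
    exact ((hδ t).add_const _).hasDerivWithinAt

theorem IsStationaryLeaderTrajectory.hasDerivWithinAt_trackingError {n : ℕ}
    {E : Fin n → Fin n → Prop} {gt : Fin n → Fin 3 → ℝ} {θ : ℝ} {d : Follower n → Fin 3 → ℝ}
    {gl : Leader n × Fin 3 → ℝ} {g : ℝ → Fin n × Fin 3 → ℝ}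
    (hg : IsStationaryLeaderTrajectory E gt θ d gl g) {t : ℝ} (ht : 0 ≤ t) :
    HasDerivWithinAt (fun τ => trackingError E gt θ gl (g τ))
      (-(closedLoop E gt θ d (trackingError E gt θ gl (g t)))) (Set.Ici 0) t :=
  (hg.follower_deriv t ht).sub_const _

/-- Global exponential convergence under the stationary-leader law, for a 2-rooted sensing graph `G`
with spanning DEP-induced graph `L`, on whose edges the matrix-valued Laplacian is built. -/
theorem mainTheorem2 (n : ℕ) (hn : 2 ≤ n)
    (G : SimpleGraph (Fin n)) (hG : IsTwoRooted G)
    (L : DEPInduced n) (hL : L.IsSpanningIn G)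
    (gt : Fin n → Fin 3 → ℝ) (θ : ℝ)
    (hrank : RankAssumption L gt θ) (hstab : StabilityAssumption L gt θ) :
    -- the follower target is well defined and is the prescribed one
    (hatFF L.Edge gt θ).det ≠ 0 ∧
    (∀ s τ : Fin 3 → ℝ,
      followerTarget L.Edge gt θ (leaderPart (targetState gt θ s τ)) =
        followerPart (targetState gt θ s τ)) ∧
    ∃ d : Follower n → Fin 3 → ℝ, (∀ k, d k ≠ 0) ∧
      -- every initial state with the leaders at their target starts a trajectory
      (∀ g₀ : Fin n × Fin 3 → ℝ, ∃ g : ℝ → Fin n × Fin 3 → ℝ, g 0 = g₀ ∧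
        IsStationaryLeaderTrajectory L.Edge gt θ d (leaderPart g₀) g) ∧
      -- and along every trajectory the error decays exponentially, with uniform constants
      ∃ c rate : ℝ, 0 < c ∧ 0 < rate ∧
        ∀ (gl : Leader n × Fin 3 → ℝ) (g : ℝ → Fin n × Fin 3 → ℝ),
          IsStationaryLeaderTrajectory L.Edge gt θ d gl g →
          ∀ t : ℝ, 0 ≤ t →
            ‖WithLp.toLp 2 (trackingError L.Edge gt θ gl (g t))‖ ≤
              c * Real.exp (-rate * t) *
                ‖WithLp.toLp 2 (trackingError L.Edge gt θ gl (g 0))‖ := by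
  choose hh mm hlt hin using fun k : Follower n => L.exists_inner hL.1 k.2
  have hinj := eq_zero_of_hatFF_mulVec_eq_zero L gt θ hrank hstab hh mm hlt hin
  have hdet : (hatFF L.Edge gt θ).det ≠ 0 := by
    intro h0
    obtain ⟨x, hx, hx0⟩ := Matrix.exists_mulVec_eq_zero_iff.2 h0
    exact hx (hinj Finset.univ (by simp) x (by simp) fun i _ => congrFun hx0 i)
  refine ⟨hdet, fun s τ => ?_, ?_⟩
  · refine followerTarget_eq_followerPart _ _ _ hdet _ fun k c => ?_
    rw [← hin k]
    exact laplacianHat_mulVec_affine gt θ s τ ((L.dep (hh k)).point_ne_point_add_two (hlt k))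
      ((L.dep (hh k)).point_ne_inner (hlt k)) ((L.dep (hh k)).point_add_two_ne_inner (hlt k))
      (L.edge_inner_iff (hh k) (hlt k)) c
  -- The level is the order of construction, path first and then position; the three components of
  -- an agent share one level.
  · obtain ⟨d, B, hd, hsymm, hB, hBA⟩ := exists_diagonal_stabilizer
      (fun p : Follower n × Fin 3 => toLex (hh p.1, mm p.1))
      (hatFF L.Edge gt θ).mulVecLin.toContinuousLinearMap hinj
    refine ⟨fun k c => d (k, c), fun k h0 => hd (k, 0) (congrFun h0 0),
      exists_isStationaryLeaderTrajectory _ _ _ _, ?_⟩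
    -- `R = diag(Θᵀ)` conjugates the closed loop into `D M̂_ff`, so `B` pulled back along `R` is a
    -- Lyapunov form for the law itself.
    let R : (Follower n × Fin 3 → ℝ) →L[ℝ] (Follower n × Fin 3 → ℝ) :=
      (diagTheta (Follower n) θ)ᵀ.mulVecLin.toContinuousLinearMap
    have hR : ∀ x, R x = (diagTheta (Follower n) θ)ᵀ *ᵥ x := fun x => rfl
    have hR0 : ∀ x, x ≠ 0 → R x ≠ 0 := by
      intro x hx h0
      apply hx
      rw [hR] at h0
      have h1 := mul_eq_one_comm.1 (diagTheta_transpose_mul (Follower n) θ)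
      rw [← Matrix.one_mulVec x, ← h1, ← Matrix.mulVec_mulVec, h0, Matrix.mulVec_zero]
    have hRK : ∀ x, R (closedLoop L.Edge gt θ (fun k c => d (k, c)) x) =
        fun i => d i * (hatFF L.Edge gt θ *ᵥ R x) i := by
      intro x
      have e : closedLoop L.Edge gt θ (fun k c => d (k, c)) x =
        (diagTheta (Follower n) θ * Matrix.diagonal d * hatFF L.Edge gt θ *
          (diagTheta (Follower n) θ)ᵀ) *ᵥ x := rfl
      rw [e, hR, hR, Matrix.mulVec_mulVec, ← Matrix.mul_assoc, ← Matrix.mul_assoc,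
        ← Matrix.mul_assoc, diagTheta_transpose_mul, Matrix.one_mul, ← Matrix.mulVec_mulVec,
        ← Matrix.mulVec_mulVec]
      ext i
      rw [Matrix.mulVec_diagonal]
    obtain ⟨c, rate, hc, hrate, hdecay⟩ := exists_exponential_decay_of_lyapunov
      (closedLoop L.Edge gt θ fun k c => d (k, c)) (B.bilinearComp R R)
      (fun x y => hsymm _ _) (fun x hx => hB _ (hR0 x hx)) fun x hx => by
        rw [ContinuousLinearMap.bilinearComp_apply, hRK]
        exact hBA _ (hR0 x hx)
    exact ⟨c, rate, hc, hrate, fun gl g hg => hdecay _ fun t ht =>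
      hg.hasDerivWithinAt_trackingError ht⟩
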